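/- Let $N\in\mathbb N$, $C_N^B=\{x\in\mathbb R^N: x_1\ge\dots\ge x_N\ge 0\}$, $C_N^D=\{x\in\mathbb R^N: x_1\ge\dots\ge x_{N-1}\ge |x_N|\}$, and $$H(x)_i=\sum_{j\ne i}\Bigl(\frac1{x_i-x_j}+\frac1{x_i+x_j}\Bigr)\qquad(i=1,\dots,N).$$ Let $x$ be in the interior of $C_N^B$, and let $\phi(t)=\phi(t,x)$, $t\ge 0$, be the solution of $\phi'=H(\phi)$, $\phi(0)=x$, in the interior of $C_N^D$. Let $(B_t)_{t\ge0}$ be an $N$-dimensional Brownian motion on a filtered probability space, and let $(W_t)_{t\ge0}$ be the continuous solution of the linear SDE with $W_0=0$ and $$dW^i_t=dB^i_t+\sum_{j\ne i}\Bigl(\frac{W^j_t-W^i_t}{(\phi_i(t)-\phi_j(t))^2}-\frac{W^j_t+W^i_t}{(\phi_i(t)+\phi_j(t))^2}\Bigr)dt\qquad(i=1,\dots,N).$$ For $k\ge 1/2$ let $(X_{t,(0,k)})_{t\ge0}$ be a Bessel process of type $B_N$ with multiplicity $(0,k)$ started at $\sqrt k\,x$ and constructed from $B$ in one of the following two ways: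 (a) reflection: $X_{t,(0,k)}$ takes values in $C_N^B$, starts at $\sqrt k\,x$, and satisfies $dX^i=dB^i+k\,H(X)_i\,dt+\mathbf 1_{\{i=N\}}\,d\ell$ with $\ell$ continuous, nondecreasing, $\ell_0=0$, increasing only when $X^N=0$; or (b) folding: $X_{t,(0,k)}=(Y^1_t,\dots,Y^{N-1}_t,|Y^N_t|)$, where $Y$ is the Bessel process of type $D_N$ with multiplicity $k$, that is, the solution in $C_N^D$ of $dY=dB+k\,H(Y)\,dt$ with $Y_0=\sqrt k\,x$. Here all processes are continuous, and the drifts are required to be defined for almost every time and locally integrable in time. Then for every $t>0$ $$\sup_{0\le s\le t,\;k\ge 1/2}\sqrt k\,\bigl\|X_{s,(0,k)}-\sqrt k\,\phi(s,x)-W_s\bigr\|<\infty\qquad\text{a.s.}$$ in the following sense. There is a real-valued random variable $C$, not depending on $k$, such that for each $k\ge1/2$, almost surely, $\sqrt k\,\|X_{s,(0,k)}-\sqrt k\,\phi(s,x)-W_s\|\le C$ for all $s\in[0,t]$. If moreover almost surely $k\mapsto X_{s,(0,k)}$ is continuous on $[1/2,\infty)$ for every $s\le t$, then almost surely the supremum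 over all $s\in[0,t]$ and all real $k\ge1/2$ is finite. -/

import Mathlib

open MeasureTheory ProbabilityTheory
open scoped NNReal

/-- The closed Weyl chamber of type `B_N`: `x_1 ≥ x_2 ≥ … ≥ x_N ≥ 0`. -/
def chamberB (N : ℕ) : Set (EuclideanSpace ℝ (Fin N)) :=
  {x | (∀ i j, i < j → x j ≤ x i) ∧ ∀ i, 0 ≤ x i}

/-- The closed Weyl chamber of type `D_N`: `x_1 ≥ … ≥ x_{N-1} ≥ |x_N|`, written in the equivalent
form `|x_j| ≤ x_i` for all `i < j`. -/
def chamberD (N : ℕ) : Set (EuclideanSpace ℝ (Fin N)) :=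
  {x | ∀ i j, i < j → |x j| ≤ x i}

/-- The vector field `H(x)_i = ∑_{j ≠ i} (1 / (x_i - x_j) + 1 / (x_i + x_j))`. -/
noncomputable def driftD {N : ℕ} (x : EuclideanSpace ℝ (Fin N)) : EuclideanSpace ℝ (Fin N) :=
  WithLp.toLp 2 fun i => ∑ j ∈ Finset.univ.erase i, (1 / (x i - x j) + 1 / (x i + x j))

/-- The linear drift
`(A w)_i = ∑_{j ≠ i} ((w_j - w_i) / (p_i - p_j)² - (w_j + w_i) / (p_i + p_j)²)`. -/
noncomputable def linearDriftD {N : ℕ} (p w : EuclideanSpace ℝ (Fin N)) :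
    EuclideanSpace ℝ (Fin N) :=
  WithLp.toLp 2 fun i => ∑ j ∈ Finset.univ.erase i,
    ((w j - w i) / (p i - p j) ^ 2 - (w j + w i) / (p i + p j) ^ 2)

/-- `φ` solves `φ' = H(φ)`, `φ(0) = x` on `[0, ∞)` inside the open chamber of type `D_N`. -/
structure IsDeterministicSolutionD {N : ℕ} (x : EuclideanSpace ℝ (Fin N))
    (φ : ℝ → EuclideanSpace ℝ (Fin N)) : Prop where
  init : φ 0 = x
  mem_interior : ∀ t, 0 ≤ t → φ t ∈ interior (chamberD N)
  ode : ∀ t, 0 ≤ t → HasDerivWithinAt φ (driftD (φ t)) (Set.Ici 0) t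

/-- The vector whose last (`N`-th) coordinate is `l`, all other coordinates being `0`. -/
noncomputable def lastCoord (N : ℕ) (l : ℝ) : EuclideanSpace ℝ (Fin N) :=
  WithLp.toLp 2 fun i => if i.val + 1 = N then l else 0

/-- `(x_1, …, x_{N-1}, x_N) ↦ (x_1, …, x_{N-1}, |x_N|)`. -/
noncomputable def foldLast {N : ℕ} (x : EuclideanSpace ℝ (Fin N)) : EuclideanSpace ℝ (Fin N) :=
  WithLp.toLp 2 fun i => if i.val + 1 = N then |x i| else x i

/-- `B` is an `N`-dimensional standard Brownian motion relative to the filtration `𝓕`. -/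
structure IsBrownianMotion {N : ℕ} {Ω : Type*} {mΩ : MeasurableSpace Ω} (P : Measure Ω)
    (𝓕 : Filtration ℝ≥0 mΩ) (B : ℝ≥0 → Ω → EuclideanSpace ℝ (Fin N)) : Prop where
  adapted : Adapted 𝓕 B
  isBrownianReal : ∀ i, IsBrownianReal (fun t ω => B t ω i) P
  iIndepFun_coord : iIndepFun (fun (i : Fin N) ω (t : ℝ≥0) => B t ω i) P
  indep_past : ∀ s t, s ≤ t →
    Indep (MeasurableSpace.comap (fun ω => B t ω - B s ω) inferInstance) (𝓕 s) P

/-- `y` is a path that solves `dy = db + k H(y) dt + dr`, `y(0) = x₀`, where `b` is the driving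
path and `r` a further forcing term (with `b(0) = r(0) = 0`). The drift has to be defined at
almost every time and locally integrable. -/
structure SolvesPathwise {N : ℕ} (k : ℝ) (x₀ : EuclideanSpace ℝ (Fin N))
    (b r y : ℝ≥0 → EuclideanSpace ℝ (Fin N)) : Prop where
  cont : Continuous y
  ae_mem_interior : ∀ᵐ s : ℝ, 0 < s → y s.toNNReal ∈ interior (chamberD N)
  integrable : ∀ t : ℝ≥0,
    IntervalIntegrable (fun s : ℝ => driftD (y s.toNNReal)) volume 0 t
  eq : ∀ t : ℝ≥0, y t = x₀ + b t + k • (∫ s in (0 : ℝ)..t, driftD (y s.toNNReal)) + r t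

/-- `Y` is the Bessel process of type `D_N` with multiplicity `k`, started at `x₀` and driven by
the Brownian motion `B`: it stays in the closed chamber of type `D_N` and
`dY^i = dB^i + k ∑_{j ≠ i} (1 / (Y^i - Y^j) + 1 / (Y^i + Y^j)) dt`. -/
structure IsBesselD {N : ℕ} {Ω : Type*} {mΩ : MeasurableSpace Ω} (P : Measure Ω)
    (𝓕 : Filtration ℝ≥0 mΩ) (B : ℝ≥0 → Ω → EuclideanSpace ℝ (Fin N)) (k : ℝ)
    (x₀ : EuclideanSpace ℝ (Fin N)) (Y : ℝ≥0 → Ω → EuclideanSpace ℝ (Fin N)) : Prop where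
  adapted : Adapted 𝓕 Y
  mem_chamber : ∀ᵐ ω ∂P, ∀ t, Y t ω ∈ chamberD N
  solves : ∀ᵐ ω ∂P, SolvesPathwise k x₀ (fun t => B t ω) 0 (fun t => Y t ω)

/-- `l` is a reflection term at `0` for the nonnegative path `u`: it is continuous and
nondecreasing, starts at `0`, and does not increase while `u` is positive. -/
structure IsReflectionTerm (u l : ℝ≥0 → ℝ) : Prop where
  cont : Continuous l
  mono : Monotone l
  init : l 0 = 0
  const : ∀ s t, s ≤ t → (∀ r ∈ Set.Icc s t, 0 < u r) → l s = l t

/-- `X` is a process in the closed chamber of type `B_N` that solves the stochastic differential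
equation of the Bessel process of type `B_N` with multiplicity `(0, k)`, driven by `B`, started
at `x₀`, with reflection on the wall `x_N = 0`:
`dX^i = dB^i + k ∑_{j ≠ i} (1 / (X^i - X^j) + 1 / (X^i + X^j)) dt + 1_{i = N} dℓ`. -/
structure IsReflectedBesselB {N : ℕ} {Ω : Type*} {mΩ : MeasurableSpace Ω} (P : Measure Ω)
    (𝓕 : Filtration ℝ≥0 mΩ) (B : ℝ≥0 → Ω → EuclideanSpace ℝ (Fin N)) (k : ℝ)
    (x₀ : EuclideanSpace ℝ (Fin N)) (X : ℝ≥0 → Ω → EuclideanSpace ℝ (Fin N)) : Prop where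
  adapted : Adapted 𝓕 X
  mem_chamber : ∀ᵐ ω ∂P, ∀ t, X t ω ∈ chamberB N
  solves : ∀ᵐ ω ∂P, ∃ l : ℝ≥0 → ℝ,
    (∀ i : Fin N, i.val + 1 = N → IsReflectionTerm (fun t => X t ω i) l) ∧
    SolvesPathwise k x₀ (fun t => B t ω) (fun t => lastCoord N (l t)) (fun t => X t ω)

/-- `X` is the process obtained from the Bessel process of type `D_N` with multiplicity `k`,
started at `x₀` and driven by `B`, by taking the absolute value of the last coordinate; it is a
Bessel process of type `B_N` with multiplicity `(0, k)`. -/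
def IsFoldedBesselB {N : ℕ} {Ω : Type*} {mΩ : MeasurableSpace Ω} (P : Measure Ω)
    (𝓕 : Filtration ℝ≥0 mΩ) (B : ℝ≥0 → Ω → EuclideanSpace ℝ (Fin N)) (k : ℝ)
    (x₀ : EuclideanSpace ℝ (Fin N)) (X : ℝ≥0 → Ω → EuclideanSpace ℝ (Fin N)) : Prop :=
  ∃ Y : ℝ≥0 → Ω → EuclideanSpace ℝ (Fin N),
    IsBesselD P 𝓕 B k x₀ Y ∧ ∀ᵐ ω ∂P, ∀ t, X t ω = foldLast (Y t ω)

/-- `X` is a Bessel process of type `B_N` with multiplicity `(0, k)`, started at `x₀` and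
constructed from the Brownian motion `B`, in one of the two standard ways: as the solution of the
equation reflected at `x_N = 0`, or as the folded process of type `D_N`. Both have the same law;
as couplings with `B` they differ, but only after the wall `x_N = 0` has been hit. -/
def IsBesselB {N : ℕ} {Ω : Type*} {mΩ : MeasurableSpace Ω} (P : Measure Ω)
    (𝓕 : Filtration ℝ≥0 mΩ) (B : ℝ≥0 → Ω → EuclideanSpace ℝ (Fin N)) (k : ℝ)
    (x₀ : EuclideanSpace ℝ (Fin N)) (X : ℝ≥0 → Ω → EuclideanSpace ℝ (Fin N)) : Prop :=
  IsReflectedBesselB P 𝓕 B k x₀ X ∨ IsFoldedBesselB P 𝓕 B k x₀ X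

/-- `W` solves `dW = dB + A(t) W dt`, `W_0 = 0`, where `A(t)` is the linear drift along `φ`. -/
structure IsGaussianLimit {N : ℕ} {Ω : Type*} {mΩ : MeasurableSpace Ω} (P : Measure Ω)
    (𝓕 : Filtration ℝ≥0 mΩ) (B : ℝ≥0 → Ω → EuclideanSpace ℝ (Fin N))
    (φ : ℝ → EuclideanSpace ℝ (Fin N)) (W : ℝ≥0 → Ω → EuclideanSpace ℝ (Fin N)) : Prop where
  adapted : Adapted 𝓕 W
  cont : ∀ᵐ ω ∂P, Continuous fun t => W t ω
  sde : ∀ᵐ ω ∂P, ∀ t : ℝ≥0,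
    W t ω = B t ω + ∫ s in (0 : ℝ)..t, linearDriftD (φ s) (W s.toNNReal ω)

/-! The estimate is pathwise. Put `z = √k φ + W`. The Brownian motion cancels in `D = X - z`, so `D`
has drift `k H(X) - √k H(φ) - A W` plus the reflection. Since `H` is homogeneous of degree `-1` and
`A` is its derivative along `φ`, Taylor expansion gives `k H(z) = √k H(φ) + A W + O(1/√k)`. Since
`H` is monotone decreasing (`inner_sub_driftD_sub_nonpos`), `⟨D, k H(X) - k H(z)⟩ ≤ 0`. The
reflection acts when `X^N = 0 < z_N` and only shrinks `‖D‖`. As `D_0 = 0`, `norm_le_of_dissipative`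
gives `‖D‖ = O(1/√k)`.

This needs `z` well inside the chamber, that is, `√k` large compared with `M = sup ‖W‖`. For smaller
`k` the comparison path is `σ₀ φ + W` with a fixed large `σ₀`; a crude error bound suffices there
because `√k < σ₀`. Folding cannot increase the distance to a point with nonnegative coordinates, so
construction (b) follows from the bound for `Y`. The resulting constant depends on the path only
through `M`, hence not on `k`. -/

/-! ### Strict inequalities in the open chambers -/

/-- The room to lower one coordinate turns the weak inequalities defining a chamber into strict
ones. -/
theorem exists_sub_single_mem_interior {N : ℕ} {S : Set (EuclideanSpace ℝ (Fin N))}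
    {x : EuclideanSpace ℝ (Fin N)} (hx : x ∈ interior S) (i : Fin N) :
    ∃ ε : ℝ, 0 < ε ∧ x - ε • EuclideanSpace.single i (1 : ℝ) ∈ S := by
  have hcont : Continuous fun ε : ℝ => x - ε • EuclideanSpace.single i (1 : ℝ) := by fun_prop
  have hev : ∀ᶠ ε : ℝ in nhds 0, x - ε • EuclideanSpace.single i (1 : ℝ) ∈ interior S :=
    hcont.continuousAt.eventually_mem (isOpen_interior.mem_nhds (by simpa using hx))
  have hev' : ∀ᶠ ε : ℝ in nhdsWithin 0 (Set.Ioi 0),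
      x - ε • EuclideanSpace.single i (1 : ℝ) ∈ interior S := hev.filter_mono nhdsWithin_le_nhds
  obtain ⟨ε, hε, hpos⟩ := (hev'.and self_mem_nhdsWithin).exists
  exact ⟨ε, hpos, interior_subset hε⟩

theorem abs_lt_of_mem_interior_chamberD {N : ℕ} {x : EuclideanSpace ℝ (Fin N)}
    (hx : x ∈ interior (chamberD N)) {i j : Fin N} (hij : i < j) : |x j| < x i := by
  obtain ⟨ε, hε, h⟩ := exists_sub_single_mem_interior hx i
  have := h i j hij
  simp [hij.ne'] at this
  linarith

theorem pos_of_mem_interior_chamberB {N : ℕ} {x : EuclideanSpace ℝ (Fin N)}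
    (hx : x ∈ interior (chamberB N)) (i : Fin N) : 0 < x i := by
  obtain ⟨ε, hε, h⟩ := exists_sub_single_mem_interior hx i
  have := h.2 i
  simp at this
  linarith

theorem sub_pos_and_add_pos {N : ℕ} {x : EuclideanSpace ℝ (Fin N)} {c : ℝ} {i j : Fin N}
    (h : c ≤ x i - |x j|) : c ≤ x i - x j ∧ c ≤ x i + x j :=
  ⟨by linarith [le_abs_self (x j)], by linarith [neg_abs_le (x j)]⟩

/-! ### Monotonicity of the drift -/

theorem sub_mul_inv_sub_inv_nonpos {a b : ℝ} (h : 0 < a * b) :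
    (a - b) * (1 / a - 1 / b) ≤ 0 := by
  have ha : a ≠ 0 := fun h0 => by simp [h0] at h
  have hb : b ≠ 0 := fun h0 => by simp [h0] at h
  have : (a - b) * (1 / a - 1 / b) = -((a - b) ^ 2 / (a * b)) := by
    field_simp
    ring
  rw [this]
  have : 0 ≤ (a - b) ^ 2 / (a * b) := by positivity
  linarith

/-- The drift is a monotone decreasing vector field on the open chamber of type `D_N`. -/
theorem inner_sub_driftD_sub_nonpos {N : ℕ} {x y : EuclideanSpace ℝ (Fin N)}
    (hx : ∀ i j, i < j → |x j| < x i) (hy : ∀ i j, i < j → |y j| < y i) :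
    inner ℝ (x - y) (driftD x - driftD y) ≤ 0 := by
  have hpos : ∀ i j, i ≠ j → 0 < (x i - x j) * (y i - y j) ∧ 0 < (x i + x j) * (y i + y j) := by
    intro i j hij
    rcases lt_or_gt_of_ne hij with h | h
    · have h1 := abs_lt.1 (hx _ _ h)
      have h2 := abs_lt.1 (hy _ _ h)
      exact ⟨mul_pos (by linarith) (by linarith), mul_pos (by linarith) (by linarith)⟩
    · have h1 := abs_lt.1 (hx _ _ h)
      have h2 := abs_lt.1 (hy _ _ h)
      exact ⟨mul_pos_of_neg_of_neg (by linarith) (by linarith),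
        mul_pos (by linarith) (by linarith)⟩
  let f : Fin N → Fin N → ℝ := fun i j => if i = j then 0 else
    (x i - y i) * ((1 / (x i - x j) - 1 / (y i - y j)) + (1 / (x i + x j) - 1 / (y i + y j)))
  have hf : inner ℝ (x - y) (driftD x - driftD y) = ∑ i, ∑ j, f i j := by
    rw [PiLp.inner_apply]
    refine Finset.sum_congr rfl fun i _ => ?_
    have h0 : ∑ j, f i j = ∑ j ∈ Finset.univ.erase i, f i j := by
      rw [← Finset.add_sum_erase _ _ (Finset.mem_univ i)]
      simp [f]
    rw [h0]
    simp only [driftD, PiLp.sub_apply, RCLike.inner_apply, conj_trivial, ← Finset.sum_sub_distrib,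
      Finset.sum_mul]
    refine Finset.sum_congr rfl fun j hj => ?_
    have hne : i ≠ j := (Finset.ne_of_mem_erase hj).symm
    simp only [f, if_neg hne]
    ring
  -- Pairing `(i, j)` with `(j, i)` turns the weights `x_i - y_i` into differences of the arguments
  -- `x_i ∓ x_j` and `y_i ∓ y_j`, to which the scalar inequality for `1 / a` applies.
  have hsymm : 2 * ∑ i, ∑ j, f i j = ∑ i, ∑ j, (f i j + f j i) := by
    simp only [Finset.sum_add_distrib]
    rw [Finset.sum_comm (f := fun i j => f j i)]
    ring
  have hle : ∑ i, ∑ j, (f i j + f j i) ≤ 0 := by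
    refine Finset.sum_nonpos fun i _ => Finset.sum_nonpos fun j _ => ?_
    by_cases hij : i = j
    · simp [f, hij]
    · obtain ⟨h1, h2⟩ := hpos i j hij
      have e1 := sub_mul_inv_sub_inv_nonpos h1
      have e2 := sub_mul_inv_sub_inv_nonpos h2
      simp only [f, if_neg hij, if_neg (Ne.symm hij)]
      have s1 : 1 / (x j - x i) = -(1 / (x i - x j)) := by
        rw [← neg_sub (x i), one_div, one_div, inv_neg]
      have s2 : 1 / (y j - y i) = -(1 / (y i - y j)) := by
        rw [← neg_sub (y i), one_div, one_div, inv_neg]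
      rw [s1, s2, add_comm (x j), add_comm (y j)]
      linarith
  linarith

/-! ### Growth of dissipative paths with reflection -/

/-- Chains steps of length `δ / 2`, which is strictly below `δ`. -/
theorem le_of_forall_close_le {ψ : ℝ → ℝ} {t δ : ℝ} (hδ : 0 < δ)
    (h : ∀ u v, 0 ≤ u → u ≤ v → v ≤ t → v - u < δ → ψ v ≤ ψ u) {s : ℝ} (hs : 0 ≤ s)
    (hst : s ≤ t) : ψ s ≤ ψ 0 := by
  have key : ∀ n : ℕ, ∀ s, 0 ≤ s → s ≤ t → s ≤ n * (δ / 2) → ψ s ≤ ψ 0 := by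
    intro n
    induction n with
    | zero =>
      intro s h0 _ h2
      have : s = 0 := le_antisymm (by simpa using h2) h0
      rw [this]
    | succ n ih =>
      intro s h0 h1 h2
      push_cast at h2
      have hu : max 0 (s - δ / 2) ≤ s := max_le h0 (by linarith)
      refine (h _ s (le_max_left 0 (s - δ / 2)) hu h1 ?_).trans
        (ih _ (le_max_left _ _) (hu.trans h1) (max_le (by positivity) (by linarith)))
      linarith [le_max_right 0 (s - δ / 2)]
  obtain ⟨n, hn⟩ := exists_nat_ge (s / (δ / 2))
  exact key n s hs hst ((div_le_iff₀ (by positivity)).1 hn)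

/-- A bound for a path with dissipative drift `g`, reflected in direction `e` only while it points
away from `e`. -/
theorem norm_le_of_dissipative {E : Type*} [NormedAddCommGroup E] [InnerProductSpace ℝ E]
    [CompleteSpace E] {D g : ℝ → E} {l : ℝ → ℝ} {e : E} {t C c : ℝ} (ht : 0 ≤ t) (hC : 0 ≤ C)
    (hc : 0 < c) (hD : Continuous D) (hg : IntervalIntegrable g volume 0 t) (hl : Monotone l)
    (hinc : ∀ u v, 0 ≤ u → u ≤ v → v ≤ t → D v - D u = (∫ r in u..v, g r) + (l v - l u) • e)
    (hlD : ∀ u v, 0 ≤ u → u ≤ v → v ≤ t → l u ≠ l v →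
      ∃ r ∈ Set.Icc u v, inner ℝ (D r) e ≤ -c)
    (hdiss : ∀ᵐ r : ℝ, 0 < r → r ≤ t → inner ℝ (D r) (g r) ≤ C * ‖D r‖)
    {s : ℝ} (hs : 0 ≤ s) (hst : s ≤ t) : ‖D s‖ ≤ ‖D 0‖ + 2 * C * t := by
  obtain ⟨p, ⟨hp0, hpt⟩, hp⟩ := (isCompact_Icc (a := (0 : ℝ)) (b := t)).exists_isMaxOn
    ⟨0, le_rfl, ht⟩ hD.norm.continuousOn
  set m := ‖D p‖ with hm
  have hDm : ∀ r, 0 ≤ r → r ≤ t → ‖D r‖ ≤ m := fun r h0 h1 => hp ⟨h0, h1⟩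
  have hm0 : 0 ≤ m := norm_nonneg _
  have hgu : ∀ u v, 0 ≤ u → u ≤ v → v ≤ t → IntervalIntegrable g volume u v := by
    intro u v h0 h1 h2
    refine hg.mono_set ?_
    rw [Set.uIcc_of_le h1, Set.uIcc_of_le ht]
    exact Set.Icc_subset_Icc h0 h2
  -- A discrete substitute for differentiating `‖D‖ ^ 2`: on short intervals `D r` is replaced by
  -- the endpoint value `D v`, at a cost of `ε ‖g r‖`.
  have key : ∀ ε : ℝ, 0 < ε → m ^ 2 ≤ ‖D 0‖ ^ 2 + 2 * C * m * t + ε * (2 * ∫ r in 0..t, ‖g r‖) := by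
    intro ε hε
    have huc := (isCompact_Icc (a := (0 : ℝ)) (b := t)).uniformContinuousOn_of_continuous
      hD.continuousOn
    -- The second bound carries `⟨D r, e⟩ ≤ -c` at one time of a short interval over to `⟨D v, e⟩ ≤
    -- 0`.
    have hη : 0 < min ε (c / (‖e‖ + 1)) := lt_min hε (by positivity)
    obtain ⟨δ, hδ, hδ'⟩ := Metric.uniformContinuousOn_iff.1 huc _ hη
    have hstep : ∀ u v, 0 ≤ u → u ≤ v → v ≤ t → v - u < δ →
        ‖D v‖ ^ 2 - ‖D u‖ ^ 2 ≤ 2 * (C * m * (v - u) + ε * ∫ r in u..v, ‖g r‖) := by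
      intro u v h0 h1 h2 h3
      have hclose : ∀ r ∈ Set.Icc u v, ‖D v - D r‖ < min ε (c / (‖e‖ + 1)) := by
        intro r hr
        rw [← dist_eq_norm]
        refine hδ' v ⟨h0.trans h1, h2⟩ r ⟨h0.trans hr.1, hr.2.trans h2⟩ ?_
        rw [Real.dist_eq, abs_of_nonneg (by linarith [hr.2])]
        linarith [hr.1]
      have hrefl : (l v - l u) * inner ℝ (D v) e ≤ 0 := by
        by_cases hne : l u = l v
        · simp [hne]
        · obtain ⟨r, hr, hre⟩ := hlD u v h0 h1 h2 hne
          refine mul_nonpos_of_nonneg_of_nonpos (sub_nonneg.2 (hl h1)) ?_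
          have h4 : inner ℝ (D v) e = inner ℝ (D v - D r) e + inner ℝ (D r) e := by
            rw [inner_sub_left]; ring
          have h5 : inner ℝ (D v - D r) e ≤ c := by
            refine (real_inner_le_norm _ _).trans ?_
            have h6 : ‖D v - D r‖ ≤ c / (‖e‖ + 1) :=
              (hclose r hr).le.trans (min_le_right _ _)
            calc ‖D v - D r‖ * ‖e‖ ≤ c / (‖e‖ + 1) * (‖e‖ + 1) :=
                  mul_le_mul h6 (by linarith) (norm_nonneg _) (by positivity)
              _ = c := by field_simp
          linarith
      have hint : inner ℝ (D v) (∫ r in u..v, g r) ≤ C * m * (v - u) + ε * ∫ r in u..v, ‖g r‖ := by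
        have hcomm : inner ℝ (D v) (∫ r in u..v, g r) = ∫ r in u..v, inner ℝ (D v) (g r) :=
          ((innerSL ℝ (D v)).intervalIntegral_comp_comm (hgu u v h0 h1 h2)).symm
        have hrhs : C * m * (v - u) + ε * ∫ r in u..v, ‖g r‖
            = ∫ r in u..v, (C * m + ε * ‖g r‖) := by
          rw [intervalIntegral.integral_add (by simp) ((hgu u v h0 h1 h2).norm.const_mul ε),
            intervalIntegral.integral_const, intervalIntegral.integral_const_mul, smul_eq_mul]
          ring
        rw [hcomm, hrhs]
        refine intervalIntegral.integral_mono_ae_restrict h1 ?_ ?_ ?_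
        · have hi := hgu u v h0 h1 h2
          exact ⟨(innerSL ℝ (D v)).integrable_comp hi.1, (innerSL ℝ (D v)).integrable_comp hi.2⟩
        · exact (by simp : IntervalIntegrable (fun _ => C * m) volume u v).add
            ((hgu u v h0 h1 h2).norm.const_mul ε)
        · have hae : ∀ᵐ r : ℝ, r ≠ 0 := by simp [ae_iff]
          filter_upwards [ae_restrict_of_ae hdiss, ae_restrict_mem measurableSet_Icc,
            ae_restrict_of_ae hae] with r hr hmem hr0
          have hr1 : 0 ≤ r := h0.trans hmem.1
          have hr2 : r ≤ t := hmem.2.trans h2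
          have h4 := hr (lt_of_le_of_ne hr1 (Ne.symm hr0)) hr2
          have h5 : inner ℝ (D v) (g r) = inner ℝ (D v - D r) (g r) + inner ℝ (D r) (g r) := by
            rw [inner_sub_left]; ring
          have h6 : inner ℝ (D v - D r) (g r) ≤ ε * ‖g r‖ :=
            (real_inner_le_norm _ _).trans (mul_le_mul_of_nonneg_right
              ((hclose r hmem).le.trans (min_le_left _ _)) (norm_nonneg _))
          have h7 : C * ‖D r‖ ≤ C * m := mul_le_mul_of_nonneg_left (hDm r hr1 hr2) hC
          show inner ℝ (D v) (g r) ≤ C * m + ε * ‖g r‖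
          linarith
      have hsq : ‖D v‖ ^ 2 - ‖D u‖ ^ 2 ≤ 2 * inner ℝ (D v) (D v - D u) := by
        have h4 := norm_sub_sq_real (D v) (D u)
        rw [inner_sub_right, real_inner_self_eq_norm_sq]
        nlinarith [sq_nonneg ‖D v - D u‖]
      rw [hinc u v h0 h1 h2, inner_add_right, inner_smul_right] at hsq
      linarith
    have hψ := le_of_forall_close_le (t := t)
      (ψ := fun s => ‖D s‖ ^ 2 - 2 * C * m * s - 2 * ε * ∫ r in 0..s, ‖g r‖) hδ (by
        intro u v h0 h1 h2 h3
        have h4 := hstep u v h0 h1 h2 h3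
        have h5 := intervalIntegral.integral_add_adjacent_intervals
          (hgu 0 u le_rfl h0 (h1.trans h2)).norm (hgu u v h0 h1 h2).norm
        show ‖D v‖ ^ 2 - 2 * C * m * v - 2 * ε * ∫ r in 0..v, ‖g r‖
          ≤ ‖D u‖ ^ 2 - 2 * C * m * u - 2 * ε * ∫ r in 0..u, ‖g r‖
        rw [← h5]
        linarith) hp0 hpt
    simp only [mul_zero, intervalIntegral.integral_same, sub_zero] at hψ
    have h6 : ∫ r in 0..p, ‖g r‖ ≤ ∫ r in 0..t, ‖g r‖ := by
      refine intervalIntegral.integral_mono_interval le_rfl hp0 hpt ?_ hg.norm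
      exact Filter.Eventually.of_forall fun r => norm_nonneg _
    have h7 : 2 * C * m * p ≤ 2 * C * m * t := by gcongr
    have h8 : ε * ∫ r in 0..p, ‖g r‖ ≤ ε * ∫ r in 0..t, ‖g r‖ := by gcongr
    linarith
  have hI : 0 ≤ ∫ r in 0..t, ‖g r‖ :=
    intervalIntegral.integral_nonneg ht fun r _ => norm_nonneg _
  have hmsq : m ^ 2 ≤ ‖D 0‖ ^ 2 + 2 * C * m * t := by
    refine le_of_forall_pos_le_add fun ε hε => ?_
    have h1 := key (ε / (2 * (∫ r in 0..t, ‖g r‖) + 1)) (by positivity)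
    have h2 : ε / (2 * (∫ r in 0..t, ‖g r‖) + 1) * (2 * ∫ r in 0..t, ‖g r‖) ≤ ε := by
      rw [div_mul_eq_mul_div, div_le_iff₀ (by positivity)]
      nlinarith
    linarith
  have h0m := hDm 0 le_rfl ht
  refine (hDm s hs hst).trans ?_
  -- If `m > ‖D 0‖ + 2 C t`, multiplying by `m ≥ ‖D 0‖` contradicts `hmsq`.
  by_contra hcon
  push Not at hcon
  nlinarith [norm_nonneg (D 0), mul_nonneg hC ht]

/-! ### Linearization error of the drift -/

theorem norm_le_of_forall_abs_le {N : ℕ} {v : EuclideanSpace ℝ (Fin N)} {C : ℝ}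
    (h : ∀ i, |v i| ≤ C) : ‖v‖ ≤ N * C := by
  have hv : v = ∑ i, EuclideanSpace.single i (v i) := by
    ext j
    simp [Finset.sum_apply]
  rw [hv]
  refine (norm_sum_le _ _).trans ?_
  refine (Finset.sum_le_sum fun i _ => ?_).trans (b := ∑ _i : Fin N, C) ?_
  · simpa using h i
  · simp

theorem abs_coord_le_norm {N : ℕ} (v : EuclideanSpace ℝ (Fin N)) (i : Fin N) : |v i| ≤ ‖v‖ := by
  simpa using PiLp.norm_apply_le v i

/-- Reduction of the linearization error of the drift to a scalar estimate. -/
theorem norm_linearization_error_le {N : ℕ} {p w : EuclideanSpace ℝ (Fin N)} {c M k σ τ : ℝ}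
    (hτ : 0 ≤ τ)
    (hp : ∀ i j, i < j → c ≤ p i - |p j|) (hw : ‖w‖ ≤ M)
    (h : ∀ a δ : ℝ, c ≤ |a| → |δ| ≤ 2 * M → |k / (σ * a + δ) - σ / a + δ / a ^ 2| ≤ τ) :
    ‖k • driftD (σ • p + w) - σ • driftD p - linearDriftD p w‖ ≤ N * (N * (2 * τ)) := by
  have hp' : ∀ i j, i ≠ j → c ≤ |p i - p j| ∧ c ≤ |p i + p j| := by
    intro i j hij
    rcases lt_or_gt_of_ne hij with hlt | hlt
    · obtain ⟨h1, h2⟩ := sub_pos_and_add_pos (hp _ _ hlt)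
      exact ⟨h1.trans (le_abs_self _), h2.trans (le_abs_self _)⟩
    · obtain ⟨h1, h2⟩ := sub_pos_and_add_pos (hp _ _ hlt)
      rw [abs_sub_comm, add_comm]
      exact ⟨h1.trans (le_abs_self _), h2.trans (le_abs_self _)⟩
  refine norm_le_of_forall_abs_le fun i => ?_
  have hsum : (k • driftD (σ • p + w) - σ • driftD p - linearDriftD p w) i =
      ∑ j ∈ Finset.univ.erase i,
        ((k / (σ * (p i - p j) + (w i - w j)) - σ / (p i - p j) + (w i - w j) / (p i - p j) ^ 2) +
        (k / (σ * (p i + p j) + (w i + w j)) - σ / (p i + p j)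
          + (w i + w j) / (p i + p j) ^ 2)) := by
    simp only [driftD, linearDriftD, PiLp.sub_apply, PiLp.add_apply, PiLp.smul_apply, smul_eq_mul,
      Finset.mul_sum, ← Finset.sum_sub_distrib]
    refine Finset.sum_congr rfl fun j _ => ?_
    rw [show σ * p i + w i - (σ * p j + w j) = σ * (p i - p j) + (w i - w j) by ring,
      show σ * p i + w i + (σ * p j + w j) = σ * (p i + p j) + (w i + w j) by ring]
    ring
  rw [hsum]
  refine (Finset.abs_sum_le_sum_abs _ _).trans ?_
  refine (Finset.sum_le_card_nsmul _ _ (2 * τ) fun j hj => ?_).trans ?_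
  · obtain ⟨h1, h2⟩ := hp' i j (Finset.ne_of_mem_erase hj).symm
    have hi := abs_le.1 ((abs_coord_le_norm w i).trans hw)
    have hj := abs_le.1 ((abs_coord_le_norm w j).trans hw)
    refine (abs_add_le _ _).trans ?_
    have e1 := h _ (w i - w j) h1 (abs_le.2 ⟨by linarith, by linarith⟩)
    have e2 := h _ (w i + w j) h2 (abs_le.2 ⟨by linarith, by linarith⟩)
    linarith
  · rw [nsmul_eq_mul]
    refine mul_le_mul_of_nonneg_right ?_ (by positivity)
    exact_mod_cast (Finset.card_le_univ _).trans (by simp)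

theorem half_mul_le_abs_mul_add {a δ c M σ : ℝ} (hσ : 0 < σ) (hσc : 4 * M ≤ σ * c)
    (ha : c ≤ |a|) (hδ : |δ| ≤ 2 * M) : σ * c / 2 ≤ |σ * a + δ| := by
  have h1 : |σ * a| ≤ |σ * a + δ| + |δ| := by
    have := abs_sub (σ * a + δ) δ
    rwa [add_sub_cancel_right] at this
  rw [abs_mul, abs_of_pos hσ] at h1
  have h2 : σ * c ≤ σ * |a| := mul_le_mul_of_nonneg_left ha hσ.le
  linarith

/-- The remainder is exactly `δ ^ 2 / (a ^ 2 * (σ * a + δ))`, and the last factor is at least `σ c /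
2` in absolute value. -/
theorem abs_taylor_error_le {a δ c M σ : ℝ} (hc : 0 < c) (hσ : 0 < σ) (hσc : 4 * M ≤ σ * c)
    (ha : c ≤ |a|) (hδ : |δ| ≤ 2 * M) :
    |σ ^ 2 / (σ * a + δ) - σ / a + δ / a ^ 2| ≤ 8 * M ^ 2 / c ^ 3 / σ := by
  have h1 := half_mul_le_abs_mul_add hσ hσc ha hδ
  have hpos : 0 < |σ * a + δ| := lt_of_lt_of_le (by positivity) h1
  have ha0 : a ≠ 0 := abs_pos.1 (hc.trans_le ha)
  have hz0 : σ * a + δ ≠ 0 := abs_pos.1 hpos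
  have heq : σ ^ 2 / (σ * a + δ) - σ / a + δ / a ^ 2 = δ ^ 2 / (a ^ 2 * (σ * a + δ)) := by
    field_simp
    ring
  rw [heq, abs_div, abs_mul, abs_pow, abs_pow]
  calc |δ| ^ 2 / (|a| ^ 2 * |σ * a + δ|) ≤ (2 * M) ^ 2 / (c ^ 2 * (σ * c / 2)) := by gcongr
    _ = 8 * M ^ 2 / c ^ 3 / σ := by
      field_simp
      ring

/-- For `σ ≠ √k` the leading terms do not cancel, so each term is bounded separately; used for small
`k`. -/
theorem abs_crude_error_le {a δ c M σ k : ℝ} (hc : 0 < c) (hσ : 0 < σ) (hσc : 4 * M ≤ σ * c)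
    (hk : 0 ≤ k) (hkσ : k ≤ σ ^ 2) (ha : c ≤ |a|) (hδ : |δ| ≤ 2 * M) :
    |k / (σ * a + δ) - σ / a + δ / a ^ 2| ≤ 3 * σ / c + 2 * M / c ^ 2 := by
  have h1 := half_mul_le_abs_mul_add hσ hσc ha hδ
  have e1 : |k / (σ * a + δ)| ≤ 2 * σ / c := by
    rw [abs_div, abs_of_nonneg hk]
    calc k / |σ * a + δ| ≤ σ ^ 2 / (σ * c / 2) := by gcongr
      _ = 2 * σ / c := by field_simp
  have e2 : |σ / a| ≤ σ / c := by
    rw [abs_div, abs_of_pos hσ]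
    gcongr
  have e3 : |δ / a ^ 2| ≤ 2 * M / c ^ 2 := by
    rw [abs_div, abs_pow]
    exact div_le_div₀ ((abs_nonneg δ).trans hδ) hδ (by positivity) (by gcongr)
  calc |k / (σ * a + δ) - σ / a + δ / a ^ 2|
      ≤ |k / (σ * a + δ)| + |σ / a| + |δ / a ^ 2| :=
        (abs_add_le _ _).trans (add_le_add_left (abs_sub _ _) _)
    _ ≤ 2 * σ / c + σ / c + 2 * M / c ^ 2 := by gcongr
    _ = 3 * σ / c + 2 * M / c ^ 2 := by ring

/-! ### The deterministic solution and its distance to the walls -/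

namespace IsDeterministicSolutionD

variable {N : ℕ} {x : EuclideanSpace ℝ (Fin N)} {φ : ℝ → EuclideanSpace ℝ (Fin N)}

theorem abs_lt (hφ : IsDeterministicSolutionD x φ) {t : ℝ} (ht : 0 ≤ t) {i j : Fin N}
    (hij : i < j) : |φ t j| < φ t i :=
  abs_lt_of_mem_interior_chamberD (hφ.mem_interior t ht) hij

/-- Freezing `φ` at negative times, where nothing is known about it, gives a path continuous on all
of `ℝ`. -/
theorem continuous_comp (hφ : IsDeterministicSolutionD x φ) :
    Continuous fun t : ℝ => φ (max 0 t) := by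
  have h : ContinuousOn φ (Set.Ici 0) := fun t ht => (hφ.ode t ht).continuousWithinAt
  exact h.comp_continuous (continuous_const.max continuous_id) fun t => Set.mem_Ici.2 (le_max_left 0 t)

theorem continuous_coord_comp (hφ : IsDeterministicSolutionD x φ) (i : Fin N) :
    Continuous fun t : ℝ => φ (max 0 t) i :=
  (EuclideanSpace.proj (𝕜 := ℝ) i).continuous.comp hφ.continuous_comp

theorem sub_ne_zero_and_add_ne_zero (hφ : IsDeterministicSolutionD x φ) {t : ℝ} (ht : 0 ≤ t)
    {i j : Fin N} (hij : i ≠ j) : φ t i - φ t j ≠ 0 ∧ φ t i + φ t j ≠ 0 := by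
  rcases lt_or_gt_of_ne hij with h | h
  · have := _root_.abs_lt.1 (hφ.abs_lt ht h)
    exact ⟨by linarith, by linarith⟩
  · have := _root_.abs_lt.1 (hφ.abs_lt ht h)
    exact ⟨by linarith, by linarith⟩

theorem continuous_driftD_comp (hφ : IsDeterministicSolutionD x φ) :
    Continuous fun t : ℝ => driftD (φ (max 0 t)) := by
  have hc := hφ.continuous_coord_comp
  refine (PiLp.continuous_toLp 2 _).comp (continuous_pi fun i => ?_)
  refine continuous_finsetSum _ fun j hj => ?_
  have hne := fun t => hφ.sub_ne_zero_and_add_ne_zero (le_max_left 0 t)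
    (Finset.ne_of_mem_erase hj).symm
  refine Continuous.add ?_ ?_
  · exact continuous_const.div ((hc i).sub (hc j)) fun t => (hne t).1
  · exact continuous_const.div ((hc i).add (hc j)) fun t => (hne t).2

theorem continuous_linearDriftD_comp (hφ : IsDeterministicSolutionD x φ)
    {w : ℝ → EuclideanSpace ℝ (Fin N)} (hw : Continuous w) :
    Continuous fun t : ℝ => linearDriftD (φ (max 0 t)) (w t) := by
  have hw' : ∀ i, Continuous fun t => w t i := fun i =>
    (EuclideanSpace.proj (𝕜 := ℝ) i).continuous.comp hw
  have hc := hφ.continuous_coord_comp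
  refine (PiLp.continuous_toLp 2 _).comp (continuous_pi fun i => ?_)
  refine continuous_finsetSum _ fun j hj => ?_
  have hne := fun t => hφ.sub_ne_zero_and_add_ne_zero (le_max_left 0 t)
    (Finset.ne_of_mem_erase hj).symm
  refine Continuous.sub ?_ ?_
  · exact ((hw' j).sub (hw' i)).div (((hc i).sub (hc j)).pow 2) fun t => pow_ne_zero 2 (hne t).1
  · exact ((hw' j).add (hw' i)).div (((hc i).add (hc j)).pow 2) fun t => pow_ne_zero 2 (hne t).2

theorem eq_add_integral (hφ : IsDeterministicSolutionD x φ) {t : ℝ} (ht : 0 ≤ t) :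
    φ t = x + ∫ s in 0..t, driftD (φ (max 0 s)) := by
  have h := intervalIntegral.integral_eq_sub_of_hasDeriv_right_of_le (f := fun s => φ (max 0 s))
    (f' := fun s => driftD (φ (max 0 s))) ht hφ.continuous_comp.continuousOn (fun s hs => by
      have h1 : HasDerivWithinAt φ (driftD (φ (max 0 s))) (Set.Ioi s) s := by
        rw [max_eq_right hs.1.le]
        exact (hφ.ode s hs.1.le).mono fun r hr => (hs.1.trans hr).le
      refine h1.congr (fun r hr => ?_) ?_
      · rw [max_eq_right (hs.1.trans hr).le]
      · rw [max_eq_right hs.1.le]) (hφ.continuous_driftD_comp.intervalIntegrable _ _)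
  rw [h, max_eq_right ht, max_self, hφ.init]
  abel

/-- The last coordinate of the deterministic solution stays positive. -/
theorem last_pos (hφ : IsDeterministicSolutionD x φ) (hx : x ∈ interior (chamberB N))
    {i : Fin N} {t : ℝ} (ht : 0 ≤ t) : 0 < φ t i := by
  let a : ℝ → ℝ := fun s => ∑ j ∈ Finset.univ.erase i,
    2 / ((φ (max 0 s) i - φ (max 0 s) j) * (φ (max 0 s) i + φ (max 0 s) j))
  have hne := fun s : ℝ => fun j (hj : j ∈ Finset.univ.erase i) =>
    hφ.sub_ne_zero_and_add_ne_zero (le_max_left 0 s) (Finset.ne_of_mem_erase hj).symm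
  have ha : Continuous a := by
    have hc := hφ.continuous_coord_comp
    refine continuous_finsetSum _ fun j hj => ?_
    exact continuous_const.div (((hc i).sub (hc j)).mul ((hc i).add (hc j))) fun s => mul_ne_zero (hne s j hj).1 (hne s j hj).2
  -- Since `1 / (p - q) + 1 / (p + q) = 2 p / ((p - q) (p + q))`, the coordinate solves a scalar
  -- linear equation and keeps its sign.
  have hdrift : ∀ s, 0 ≤ s → driftD (φ s) i = a s * φ s i := by
    intro s hs
    simp only [driftD, a, Finset.sum_mul, max_eq_right hs]
    refine Finset.sum_congr rfl fun j hj => ?_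
    have h := hne s j hj
    rw [max_eq_right hs] at h
    obtain ⟨h1, h2⟩ := h
    field_simp
    ring
  have hG : ∀ s, HasDerivAt (fun u => ∫ r in (0 : ℝ)..u, a r) (a s) s := fun s =>
    (ha.integral_hasStrictDerivAt 0 s).hasDerivAt
  have hconst := constant_of_has_deriv_right_zero
    (f := fun s => φ s i * Real.exp (-∫ r in (0 : ℝ)..s, a r)) (a := 0) (b := t) (by
      have h1 : ContinuousOn φ (Set.Icc 0 t) := fun s hs =>
        (hφ.ode s hs.1).continuousWithinAt.mono fun r hr => hr.1
      have h2 : Continuous fun s : ℝ => ∫ r in (0 : ℝ)..s, a r :=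
        continuous_iff_continuousAt.2 fun s => (hG s).continuousAt
      exact ((EuclideanSpace.proj (𝕜 := ℝ) i).continuous.comp_continuousOn
        h1).mul (Real.continuous_exp.comp h2.neg).continuousOn) (by
      intro s hs
      have h1 : HasDerivWithinAt (fun s => φ s i) (driftD (φ s) i) (Set.Ici s) s := by
        have := ((EuclideanSpace.proj (𝕜 := ℝ) i).hasFDerivAt
          (x := φ s)).comp_hasDerivWithinAt s
          ((hφ.ode s hs.1).mono (Set.Ici_subset_Ici.2 hs.1))
        exact this
      have h2 := h1.mul ((hG s).neg.exp.hasDerivWithinAt (s := Set.Ici s))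
      refine h2.congr_deriv ?_
      rw [hdrift s hs.1]
      simp only [Pi.neg_apply]
      ring) t ⟨ht, le_rfl⟩
  simp only [intervalIntegral.integral_same, neg_zero, Real.exp_zero, mul_one, hφ.init] at hconst
  have hpos : 0 < φ t i * Real.exp (-∫ r in (0 : ℝ)..t, a r) := by
    rw [hconst]
    exact pos_of_mem_interior_chamberB hx i
  exact pos_of_mul_pos_left hpos (Real.exp_pos _).le

/-- On compact time intervals the deterministic solution keeps a positive distance to all walls. -/
theorem exists_gap (hφ : IsDeterministicSolutionD x φ) (hx : x ∈ interior (chamberB N)) {t : ℝ}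
    (ht : 0 ≤ t) : ∃ c : ℝ, 0 < c ∧ ∀ s, 0 ≤ s → s ≤ t →
      (∀ i j, i < j → c ≤ φ s i - |φ s j|) ∧ ∀ i, c ≤ φ s i := by
  have key : ∀ f : ℝ → ℝ, Continuous f → (∀ s, 0 ≤ s → 0 < f s) →
      ∀ᶠ c in nhdsWithin (0 : ℝ) (Set.Ioi 0), ∀ s, 0 ≤ s → s ≤ t → c ≤ f s := by
    intro f hf hpos
    obtain ⟨p, hp, hmin⟩ := (isCompact_Icc (a := (0 : ℝ)) (b := t)).exists_isMinOn
      ⟨0, le_rfl, ht⟩ hf.continuousOn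
    have : ∀ᶠ c in nhdsWithin (0 : ℝ) (Set.Ioi 0), c < f p :=
      (eventually_lt_nhds (hpos p hp.1)).filter_mono nhdsWithin_le_nhds
    filter_upwards [this] with c hc s h0 h1
    exact hc.le.trans (hmin ⟨h0, h1⟩)
  have hc := hφ.continuous_coord_comp
  have h1 : ∀ᶠ c in nhdsWithin (0 : ℝ) (Set.Ioi 0), ∀ i j, i < j → ∀ s, 0 ≤ s → s ≤ t →
      c ≤ φ (max 0 s) i - |φ (max 0 s) j| := by
    refine Filter.eventually_all.2 fun i => Filter.eventually_all.2 fun j => ?_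
    by_cases hij : i < j
    · filter_upwards [key (fun s => φ (max 0 s) i - |φ (max 0 s) j|) ((hc i).sub (hc j).abs)
        fun s _ => sub_pos.2 (hφ.abs_lt (le_max_left _ _) hij)] with c hc _
      exact hc
    · exact Filter.Eventually.of_forall fun c h => absurd h hij
  have h2 : ∀ᶠ c in nhdsWithin (0 : ℝ) (Set.Ioi 0), ∀ i, ∀ s, 0 ≤ s → s ≤ t →
      c ≤ φ (max 0 s) i :=
    Filter.eventually_all.2 fun i => key (fun s => φ (max 0 s) i) (hc i) fun s _ =>
      hφ.last_pos hx (le_max_left _ _)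
  obtain ⟨c, ⟨hc1, hc2⟩, hc0⟩ := ((h1.and h2).and self_mem_nhdsWithin).exists
  refine ⟨c, hc0, fun s h0 hst => ⟨fun i j hij => ?_, fun i => ?_⟩⟩
  · simpa only [max_eq_right h0] using hc1 i j hij s h0 hst
  · simpa only [max_eq_right h0] using hc2 i s h0 hst

end IsDeterministicSolutionD

/-! ### Pathwise comparison -/

theorem lastCoord_sub {N : ℕ} (a b : ℝ) :
    lastCoord N a - lastCoord N b = (a - b) • lastCoord N 1 := by
  ext i
  by_cases h : i.val + 1 = N <;> simp [lastCoord, h]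

theorem lastCoord_zero {N : ℕ} : lastCoord N 0 = 0 := by
  ext i
  simp [lastCoord]

theorem inner_lastCoord {N : ℕ} (v : EuclideanSpace ℝ (Fin N)) {i : Fin N} (hi : i.val + 1 = N) :
    inner ℝ v (lastCoord N 1) = v i := by
  rw [PiLp.inner_apply, Finset.sum_eq_single i]
  · simp [lastCoord, hi]
  · intro j _ hj
    have : j.val + 1 ≠ N := fun h => hj (Fin.ext (by omega))
    simp [lastCoord, this]
  · simp

theorem norm_foldLast_sub_le {N : ℕ} {y z : EuclideanSpace ℝ (Fin N)}
    (hz : ∀ i, 0 ≤ z i) : ‖foldLast y - z‖ ≤ ‖y - z‖ := by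
  rw [EuclideanSpace.norm_eq, EuclideanSpace.norm_eq]
  refine Real.sqrt_le_sqrt (Finset.sum_le_sum fun i _ => ?_)
  refine pow_le_pow_left₀ (norm_nonneg _) ?_ 2
  simp only [PiLp.sub_apply, foldLast, Real.norm_eq_abs]
  split_ifs with h
  · simpa [abs_of_nonneg (hz i)] using abs_abs_sub_abs_le (y i) (z i)
  · exact le_rfl

/-- Pathwise comparison of a (possibly reflected) solution with `σ φ + w`, where `φ` is the
deterministic solution and `w` the solution of the linearized equation. -/
theorem SolvesPathwise.norm_sub_le {N : ℕ} (hN : 0 < N) {x : EuclideanSpace ℝ (Fin N)}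
    {φ : ℝ → EuclideanSpace ℝ (Fin N)} (hφ : IsDeterministicSolutionD x φ)
    {k σ τ c M : ℝ} {t : ℝ≥0} (hk : 0 ≤ k) (hσ : 0 < σ) (hτ : 0 ≤ τ) (hσc : M < σ * c)
    (hσc' : 2 * M < σ * c)
    (hgap : ∀ s : ℝ, 0 ≤ s → s ≤ t → (∀ i j, i < j → c ≤ φ s i - |φ s j|) ∧ ∀ i, c ≤ φ s i)
    (herr : ∀ a δ : ℝ, c ≤ |a| → |δ| ≤ 2 * M → |k / (σ * a + δ) - σ / a + δ / a ^ 2| ≤ τ)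
    {b w y : ℝ≥0 → EuclideanSpace ℝ (Fin N)} {l : ℝ≥0 → ℝ} (hwc : Continuous w)
    (hw : ∀ s : ℝ≥0, w s = b s + ∫ r in (0 : ℝ)..s, linearDriftD (φ r) (w r.toNNReal))
    (hwM : ∀ s ≤ t, ‖w s‖ ≤ M)
    (hy : SolvesPathwise k (√k • x) b (fun s => lastCoord N (l s)) y) (hl : Monotone l)
    (hl0 : l 0 = 0)
    (hly : ∀ u v, u ≤ v → l u ≠ l v → ∃ r ∈ Set.Icc u v, ∀ i : Fin N, i.val + 1 = N → y r i ≤ 0)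
    {s : ℝ≥0} (hs : s ≤ t) :
    ‖y s - (σ • φ s + w s)‖ ≤ |√k - σ| * ‖x‖ + 2 * (N * (N * (2 * τ))) * t := by
  -- The driving path `b` cancels in `D`. Taking `σ ≠ √k` costs only the initial value `(√k - σ) x`
  -- and a larger `τ`.
  let D : ℝ → EuclideanSpace ℝ (Fin N) := fun r =>
    y r.toNNReal - (σ • φ (max 0 r) + w r.toNNReal)
  let g : ℝ → EuclideanSpace ℝ (Fin N) := fun r =>
    k • driftD (y r.toNNReal) - σ • driftD (φ (max 0 r)) - linearDriftD (φ (max 0 r)) (w r.toNNReal)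
  have hwr : Continuous fun r : ℝ => w r.toNNReal := hwc.comp continuous_real_toNNReal
  have hDc : Continuous D := (hy.cont.comp continuous_real_toNNReal).sub
    ((hφ.continuous_comp.const_smul σ).add hwr)
  have hHφ : ∀ u v, IntervalIntegrable (fun r => driftD (φ (max 0 r))) volume u v :=
    hφ.continuous_driftD_comp.intervalIntegrable
  have hA : ∀ u v, IntervalIntegrable
      (fun r => linearDriftD (φ (max 0 r)) (w r.toNNReal)) volume u v :=
    (hφ.continuous_linearDriftD_comp hwr).intervalIntegrable
  have hgi : ∀ u : ℝ≥0, IntervalIntegrable g volume 0 u := fun u =>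
    (((hy.integrable u).smul k).sub ((hHφ 0 u).smul σ)).sub (hA 0 u)
  have hDeq : ∀ u : ℝ, 0 ≤ u → D u = (√k - σ) • x + (∫ r in (0 : ℝ)..u, g r)
      + lastCoord N (l u.toNNReal) := by
    intro u hu
    lift u to ℝ≥0 using hu
    have h1 : ∫ r in (0 : ℝ)..u, g r = k • (∫ r in (0 : ℝ)..u, driftD (y r.toNNReal))
        - σ • (∫ r in (0 : ℝ)..u, driftD (φ (max 0 r)))
        - ∫ r in (0 : ℝ)..u, linearDriftD (φ (max 0 r)) (w r.toNNReal) := by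
      have e1 : IntervalIntegrable (fun r : ℝ => k • driftD (y r.toNNReal)) volume 0 u :=
        (hy.integrable u).smul k
      have e2 : IntervalIntegrable (fun r : ℝ => σ • driftD (φ (max 0 r))) volume 0 u :=
        (hHφ 0 u).smul σ
      simp only [g]
      rw [intervalIntegral.integral_sub (e1.sub e2)
        (hA 0 u), intervalIntegral.integral_sub e1 e2,
        intervalIntegral.integral_smul, intervalIntegral.integral_smul]
    have h2 : ∫ r in (0 : ℝ)..u, linearDriftD (φ r) (w r.toNNReal)
        = ∫ r in (0 : ℝ)..u, linearDriftD (φ (max 0 r)) (w r.toNNReal) := by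
      refine intervalIntegral.integral_congr fun r hr => ?_
      rw [Set.uIcc_of_le u.coe_nonneg] at hr
      simp only [max_eq_right hr.1]
    simp only [D, Real.toNNReal_coe, max_eq_right u.coe_nonneg]
    rw [hy.eq u, hw u, hφ.eq_add_integral u.coe_nonneg, h1, h2]
    module
  have hinc : ∀ u v, 0 ≤ u → u ≤ v → v ≤ (t : ℝ) →
      D v - D u = (∫ r in u..v, g r) + (l v.toNNReal - l u.toNNReal) • lastCoord N 1 := by
    intro u v h0 h1 _
    have hu : IntervalIntegrable g volume 0 u := hgi ⟨u, h0⟩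
    have hv : IntervalIntegrable g volume 0 v := hgi ⟨v, h0.trans h1⟩
    rw [hDeq u h0, hDeq v (h0.trans h1), ← intervalIntegral.integral_interval_sub_left hv hu,
      ← lastCoord_sub]
    abel
  have hD0 : D 0 = (√k - σ) • x := by
    rw [hDeq 0 le_rfl]
    simp [hl0, lastCoord_zero]
  have hcoord : ∀ r ≤ t, ∀ i, |w r i| ≤ M := fun r hr i =>
    (abs_coord_le_norm _ _).trans (hwM r hr)
  -- At some time while `l` grows, the last coordinate of `y` is at most `0`, whereas that of `σ φ +
  -- w` is at least `σ c - M`.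
  have hrefl : ∀ u v, 0 ≤ u → u ≤ v → v ≤ (t : ℝ) → l u.toNNReal ≠ l v.toNNReal →
      ∃ r ∈ Set.Icc u v, inner ℝ (D r) (lastCoord N 1) ≤ -(σ * c - M) := by
    intro u v h0 h1 h2 hne
    obtain ⟨r, ⟨hr1, hr2⟩, hr⟩ := hly _ _ (Real.toNNReal_le_toNNReal h1) hne
    have hr1' : u ≤ r := Real.toNNReal_le_iff_le_coe.1 hr1
    have hr2' : (r : ℝ) ≤ v := (Real.le_toNNReal_iff_coe_le (h0.trans h1)).1 hr2
    refine ⟨r, ⟨hr1', hr2'⟩, ?_⟩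
    have hlast : (⟨N - 1, by omega⟩ : Fin N).val + 1 = N := by
      show N - 1 + 1 = N
      omega
    rw [inner_lastCoord _ hlast]
    have e1 := hr _ hlast
    have e2 := abs_le.1 (hcoord r (by exact_mod_cast hr2'.trans h2) ⟨N - 1, by omega⟩)
    have e3 := mul_le_mul_of_nonneg_left
      ((hgap r r.coe_nonneg (hr2'.trans h2)).2 ⟨N - 1, by omega⟩) hσ.le
    simp only [D, Real.toNNReal_coe, max_eq_right r.coe_nonneg, PiLp.sub_apply, PiLp.add_apply,
      PiLp.smul_apply, smul_eq_mul]
    linarith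
  have hdiss : ∀ᵐ r : ℝ, 0 < r → r ≤ (t : ℝ) →
      inner ℝ (D r) (g r) ≤ (N * (N * (2 * τ))) * ‖D r‖ := by
    filter_upwards [hy.ae_mem_interior] with r hr h0 h1
    obtain ⟨hg1, hg2⟩ := hgap r h0.le h1
    have hrt : r.toNNReal ≤ t := by
      rw [Real.toNNReal_le_iff_le_coe]
      exact h1
    set z := σ • φ r + w r.toNNReal with hz
    have hz' : ∀ i j, i < j → |z j| < z i := by
      intro i j hij
      have e1 := abs_le.1 (hcoord _ hrt i)
      have e2 := hcoord _ hrt j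
      have e3 := mul_le_mul_of_nonneg_left (hg1 i j hij) hσ.le
      have e4 : |σ * φ r j + w r.toNNReal j| ≤ σ * |φ r j| + |w r.toNNReal j| := by
        refine (abs_add_le _ _).trans ?_
        rw [abs_mul, abs_of_pos hσ]
      simp only [hz, PiLp.add_apply, PiLp.smul_apply, smul_eq_mul]
      linarith
    have hmono := inner_sub_driftD_sub_nonpos
      (fun i j hij => abs_lt_of_mem_interior_chamberD (hr h0) hij) hz'
    have hE := norm_linearization_error_le hτ hg1 (hwM _ hrt) herr
    rw [← hz] at hE
    simp only [D, g, max_eq_right h0.le]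
    -- The drift splits into a monotone part, with nonpositive inner product, and the linearization
    -- error at `z`.
    rw [← hz, show k • driftD (y r.toNNReal) - σ • driftD (φ r) - linearDriftD (φ r) (w r.toNNReal)
      = k • (driftD (y r.toNNReal) - driftD z) + (k • driftD z - σ • driftD (φ r)
        - linearDriftD (φ r) (w r.toNNReal)) by module, inner_add_right, inner_smul_right]
    have e1 := mul_nonpos_of_nonneg_of_nonpos hk hmono
    have e2 := (real_inner_le_norm (y r.toNNReal - z) _).trans
      (mul_le_mul_of_nonneg_left hE (norm_nonneg (y r.toNNReal - z)))
    linarith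
  have hmain := norm_le_of_dissipative t.coe_nonneg (by positivity) (sub_pos.2 hσc) hDc (hgi t)
    (hl.comp fun _ _ h => Real.toNNReal_le_toNNReal h) hinc hrefl hdiss s.coe_nonneg (by exact_mod_cast hs)
  rw [hD0, norm_smul, Real.norm_eq_abs] at hmain
  simpa only [D, Real.toNNReal_coe, max_eq_right s.coe_nonneg] using hmain

/-- A pathwise bound that depends on the path `w` only through an upper bound for its norm. -/
theorem exists_pathwise_bound {N : ℕ} (hN : 0 < N) {x : EuclideanSpace ℝ (Fin N)}
    (hx : x ∈ interior (chamberB N)) {φ : ℝ → EuclideanSpace ℝ (Fin N)}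
    (hφ : IsDeterministicSolutionD x φ) (t : ℝ≥0) {M : ℝ} (hM : 0 ≤ M) :
    ∃ C : ℝ, ∀ k : ℝ, 0 < k → ∀ b w : ℝ≥0 → EuclideanSpace ℝ (Fin N), Continuous w →
      (∀ s : ℝ≥0, w s = b s + ∫ r in (0 : ℝ)..s, linearDriftD (φ r) (w r.toNNReal)) →
      (∀ s ≤ t, ‖w s‖ ≤ M) →
      ∀ (y z : ℝ≥0 → EuclideanSpace ℝ (Fin N)) (l : ℝ≥0 → ℝ),
      SolvesPathwise k (√k • x) b (fun s => lastCoord N (l s)) y → Monotone l → l 0 = 0 →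
      (∀ u v, u ≤ v → l u ≠ l v →
        ∃ r ∈ Set.Icc u v, ∀ i : Fin N, i.val + 1 = N → y r i ≤ 0) →
      (∀ s, z s = y s ∨ z s = foldLast (y s)) →
      ∀ s ≤ t, √k * ‖z s - √k • φ s - w s‖ ≤ C := by
  obtain ⟨c, hc, hgap⟩ := hφ.exists_gap hx t.coe_nonneg
  obtain ⟨p, _, hp⟩ := (isCompact_Icc (a := (0 : ℝ)) (b := t)).exists_isMaxOn
    ⟨0, le_rfl, t.coe_nonneg⟩ hφ.continuous_comp.norm.continuousOn
  set Φ := ‖φ (max 0 p)‖ with hΦ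
  -- Then `σ₀ c` dominates `4 M` and strictly exceeds `2 M`, even when `M = 0`.
  set σ₀ := (4 * M + 4) / c with hσ₀
  have hσ₀pos : 0 < σ₀ := by positivity
  have hσ₀c : σ₀ * c = 4 * M + 4 := by
    rw [hσ₀]
    field_simp
  set τ := 3 * σ₀ / c + 2 * M / c ^ 2 with hτ
  have hτ0 : 0 ≤ τ := by positivity
  set C₁ := 2 * (N * (N * (2 * (8 * M ^ 2 / c ^ 3)))) * (t : ℝ) with hC₁
  set C₂ := σ₀ * ((σ₀ * ‖x‖ + 2 * (N * (N * (2 * τ))) * (t : ℝ)) + σ₀ * Φ) with hC₂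
  have hC₁0 : 0 ≤ C₁ := by positivity
  have hC₂0 : 0 ≤ C₂ := by positivity
  refine ⟨C₁ + C₂, fun k hk b w hwc hw hwM y z l hy hl hl0 hly hz s hs => ?_⟩
  have hfold : ∀ σ : ℝ, σ₀ ≤ σ → ‖z s - (σ • φ s + w s)‖ ≤ ‖y s - (σ • φ s + w s)‖ := by
    intro σ hσ
    rcases hz s with h | h
    · rw [h]
    · rw [h]
      refine norm_foldLast_sub_le fun i => ?_
      have e1 := abs_le.1 ((abs_coord_le_norm (w s) i).trans (hwM s hs))
      have e2 := (hgap s s.coe_nonneg (by exact_mod_cast hs)).2 i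
      have e3 : σ₀ * c ≤ σ * φ s i := mul_le_mul hσ e2 hc.le (hσ₀pos.le.trans hσ)
      simp only [PiLp.add_apply, PiLp.smul_apply, smul_eq_mul]
      linarith
  have hsk : 0 < √k := Real.sqrt_pos.2 hk
  rcases le_or_gt σ₀ (√k) with hcase | hcase
  -- Large `k`: with `σ = √k` the initial term vanishes and the Taylor error `O(1/√k)` absorbs the
  -- prefactor `√k`.
  · have hσc : σ₀ * c ≤ √k * c := mul_le_mul_of_nonneg_right hcase hc.le
    have h := hy.norm_sub_le hN hφ (σ := √k) (τ := 8 * M ^ 2 / c ^ 3 / √k) (c := c) (M := M) hk.le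
      hsk (by positivity) (by linarith) (by linarith) hgap (fun a δ ha hδ => by
        have := abs_taylor_error_le hc hsk (by linarith) ha hδ
        rwa [Real.sq_sqrt hk.le] at this) hwc hw hwM hl hl0 hly hs
    have h' := (hfold (√k) hcase).trans h
    rw [sub_self, abs_zero, zero_mul, zero_add, ← sub_sub] at h'
    have h'' := mul_le_mul_of_nonneg_left h' hsk.le
    have heq : √k * (2 * (N * (N * (2 * (8 * M ^ 2 / c ^ 3 / √k)))) * (t : ℝ)) = C₁ := by
      rw [hC₁]
      field_simp
    linarith
  -- Small `k`: compare with `σ₀ φ + w`, then return to `√k φ + w` at the cost `|σ₀ - √k| ‖φ‖ ≤ σ₀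
  -- Φ`.
  · have hkσ : k ≤ σ₀ ^ 2 := by
      rw [← Real.sq_sqrt hk.le]
      exact pow_le_pow_left₀ hsk.le hcase.le 2
    have h := hy.norm_sub_le hN hφ (σ := σ₀) (τ := τ) (c := c) (M := M) hk.le hσ₀pos hτ0
      (by linarith) (by linarith) hgap (fun a δ ha hδ =>
        abs_crude_error_le hc hσ₀pos (by linarith) hk.le hkσ ha hδ) hwc hw hwM hl hl0 hly hs
    have h' := (hfold σ₀ le_rfl).trans h
    have habs : |√k - σ₀| ≤ σ₀ := by
      rw [abs_sub_comm, abs_of_pos (sub_pos.2 hcase)]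
      linarith
    have habs' : |σ₀ - √k| ≤ σ₀ := by rwa [abs_sub_comm]
    have hΦs : ‖φ s‖ ≤ Φ := by
      have := hp (show (s : ℝ) ∈ Set.Icc (0 : ℝ) t from ⟨s.coe_nonneg, by exact_mod_cast hs⟩)
      change ‖φ (max 0 (s : ℝ))‖ ≤ Φ at this
      rwa [max_eq_right s.coe_nonneg] at this
    have hsplit : z s - √k • φ s - w s = (z s - (σ₀ • φ s + w s)) + (σ₀ - √k) • φ s := by module
    have hnorm : ‖z s - √k • φ s - w s‖
        ≤ (σ₀ * ‖x‖ + 2 * (N * (N * (2 * τ))) * (t : ℝ)) + σ₀ * Φ := by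
      rw [hsplit]
      refine (norm_add_le _ _).trans (add_le_add (h'.trans ?_) ?_)
      · gcongr
      · rw [norm_smul, Real.norm_eq_abs]
        gcongr
    have : √k * ‖z s - √k • φ s - w s‖ ≤ C₂ :=
      mul_le_mul hcase.le hnorm (norm_nonneg _) hσ₀pos.le
    linarith

/-! ### From pathwise to almost sure bounds -/

/-- A measurable integer-valued bound for a process with almost surely continuous paths. -/
theorem exists_measurable_nat_bound {N : ℕ} {Ω : Type*} [MeasurableSpace Ω] {P : Measure Ω}
    {W : ℝ≥0 → Ω → EuclideanSpace ℝ (Fin N)} (hW : ∀ s, Measurable (W s))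
    (hc : ∀ᵐ ω ∂P, Continuous fun s => W s ω) (t : ℝ≥0) :
    ∃ m : Ω → ℕ, Measurable m ∧ ∀ᵐ ω ∂P, ∀ s ≤ t, ‖W s ω‖ ≤ m ω := by
  obtain ⟨S, hS, hSd⟩ := TopologicalSpace.exists_countable_dense ℝ≥0
  have := hS.to_subtype
  let f : Ω → ENNReal := fun ω => ⨆ s : S, ‖W (min s t) ω‖ₑ
  have hf : Measurable f := .iSup fun s => (hW _).enorm
  refine ⟨fun ω => ⌈(f ω).toReal⌉₊, hf.ennreal_toReal.nat_ceil, ?_⟩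
  filter_upwards [hc] with ω hω
  have hcont : Continuous fun s : ℝ≥0 => ‖W (min s t) ω‖ₑ :=
    (hω.comp (continuous_id.min continuous_const)).enorm
  have hle : ∀ s : ℝ≥0, ‖W (min s t) ω‖ₑ ≤ f ω := by
    have hcl : IsClosed {s : ℝ≥0 | ‖W (min s t) ω‖ₑ ≤ f ω} := isClosed_le hcont continuous_const
    intro s
    exact hcl.closure_subset_iff.2
      (fun r hr => le_iSup (fun s : S => ‖W (min s t) ω‖ₑ) ⟨r, hr⟩) (hSd s)
  have hfin : f ω ≠ ⊤ := by
    obtain ⟨R, hR⟩ := ((isCompact_Icc (a := (0 : ℝ≥0)) (b := t)).image hω).isBounded.exists_norm_le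
    refine ne_top_of_le_ne_top (ENNReal.ofReal_ne_top (r := R)) (iSup_le fun s => ?_)
    rw [← ofReal_norm]
    exact ENNReal.ofReal_le_ofReal (hR _ ⟨_, ⟨zero_le, min_le_right _ _⟩, rfl⟩)
  intro s hs
  have h1 := ENNReal.toReal_mono hfin (hle s)
  rw [min_eq_left hs, toReal_enorm] at h1
  exact h1.trans (Nat.le_ceil _)

theorem bddAbove_of_forall_rat {E : Type*} [NormedAddCommGroup E] [NormedSpace ℝ E]
    {X : ℝ → ℝ≥0 → E} {φ w : ℝ≥0 → E} {t : ℝ≥0} {C : ℝ}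
    (hX : ∀ s ≤ t, ContinuousOn (fun k => X k s) (Set.Ici (1 / 2)))
    (h : ∀ q : ℚ, (1 / 2 : ℝ) ≤ q → ∀ s ≤ t, √(q : ℝ) * ‖X q s - √(q : ℝ) • φ s - w s‖ ≤ C) :
    BddAbove {r : ℝ | ∃ s : ℝ≥0, s ≤ t ∧ ∃ k : ℝ, 1 / 2 ≤ k ∧
      r = √k * ‖X k s - √k • φ s - w s‖} := by
  refine ⟨C, ?_⟩
  rintro _ ⟨s, hs, k, hk, rfl⟩
  have hcont : ContinuousOn (fun k => √k * ‖X k s - √k • φ s - w s‖) (Set.Ici (1 / 2)) := by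
    have h1 := hX s hs
    have h2 : ContinuousOn (fun k : ℝ => √k) (Set.Ici (1 / 2)) :=
      Real.continuous_sqrt.continuousOn
    exact h2.mul ((h1.sub (h2.smul continuousOn_const)).sub continuousOn_const).norm
  -- The open half-line makes density of the rationals applicable, and its closure still contains
  -- the endpoint `1 / 2`.
  have hmem : k ∈ closure (Set.Ioi (1 / 2 : ℝ) ∩ Set.range ((↑) : ℚ → ℝ)) := by
    have hd : Dense (Set.range ((↑) : ℚ → ℝ)) := Rat.isDenseEmbedding_coe_real.dense
    refine closure_minimal (hd.open_subset_closure_inter isOpen_Ioi) isClosed_closure ?_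
    rw [closure_Ioi]
    exact hk
  have hcl := (hcont k hk).mono (Set.inter_subset_left.trans Set.Ioi_subset_Ici_self :
    Set.Ioi (1 / 2 : ℝ) ∩ Set.range ((↑) : ℚ → ℝ) ⊆ _)
  have := mem_closure_iff_nhdsWithin_neBot.1 hmem
  refine le_of_tendsto hcl.tendsto ?_
  filter_upwards [self_mem_nhdsWithin] with r hr
  obtain ⟨hr1, q, rfl⟩ := hr
  exact h q (le_of_lt hr1) s hs

theorem theorem5p2 {N : ℕ} {Ω : Type*} {mΩ : MeasurableSpace Ω} (P : Measure Ω)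
    [IsProbabilityMeasure P] (𝓕 : Filtration ℝ≥0 mΩ)
    (B : ℝ≥0 → Ω → EuclideanSpace ℝ (Fin N)) (hB : IsBrownianMotion P 𝓕 B)
    (x : EuclideanSpace ℝ (Fin N)) (hx : x ∈ interior (chamberB N))
    (φ : ℝ → EuclideanSpace ℝ (Fin N)) (hφ : IsDeterministicSolutionD x φ)
    (W : ℝ≥0 → Ω → EuclideanSpace ℝ (Fin N)) (hW : IsGaussianLimit P 𝓕 B φ W)
    (X : ℝ → ℝ≥0 → Ω → EuclideanSpace ℝ (Fin N))
    (hX : ∀ k : ℝ, 1 / 2 ≤ k → IsBesselB P 𝓕 B k (√k • x) (X k))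
    (t : ℝ≥0) (ht : 0 < t) :
    -- the bound is an a.s. finite random variable, uniform in `s ≤ t` and in `k`
    -- (each process `X k` being determined only up to a null set that may depend on `k`)
    (∃ C : Ω → ℝ, Measurable C ∧ ∀ k : ℝ, 1 / 2 ≤ k → ∀ᵐ ω ∂P, ∀ s : ℝ≥0, s ≤ t →
      √k * ‖X k s ω - √k • φ s - W s ω‖ ≤ C ω) ∧
    -- for versions continuous in `k`, the supremum over all `s ≤ t` and `k` is a.s. finite
    ((∀ᵐ ω ∂P, ∀ s : ℝ≥0, s ≤ t → ContinuousOn (fun k => X k s ω) (Set.Ici (1 / 2))) →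
      ∀ᵐ ω ∂P, BddAbove {r : ℝ | ∃ s : ℝ≥0, s ≤ t ∧ ∃ k : ℝ, 1 / 2 ≤ k ∧
        r = √k * ‖X k s ω - √k • φ s - W s ω‖}) := by
  have hfirst : ∃ C : Ω → ℝ, Measurable C ∧ ∀ k : ℝ, 1 / 2 ≤ k → ∀ᵐ ω ∂P, ∀ s : ℝ≥0, s ≤ t →
      √k * ‖X k s ω - √k • φ s - W s ω‖ ≤ C ω := by
    rcases Nat.eq_zero_or_pos N with rfl | hN
    · refine ⟨fun _ => 0, measurable_const, fun k _ => Filter.Eventually.of_forall fun ω s _ => ?_⟩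
      rw [Subsingleton.elim (X k s ω - √k • φ s - W s ω) 0, norm_zero, mul_zero]
    · obtain ⟨m, hm, hWm⟩ := exists_measurable_nat_bound
        (fun s => (hW.adapted s).mono (𝓕.le s) le_rfl) hW.cont t
      choose F hF using fun n : ℕ => exists_pathwise_bound hN hx hφ t (M := n) n.cast_nonneg
      -- As `m` is integer-valued, `F ∘ m` is measurable for any choice of the constants `F n`.
      refine ⟨fun ω => F (m ω), measurable_from_nat.comp hm, fun k hk => ?_⟩
      have hk0 : 0 < k := by linarith
      rcases hX k hk with h | ⟨Y, hY, hXY⟩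
      · filter_upwards [hWm, hW.cont, hW.sde, h.solves] with ω h1 h2 h3 h4
        obtain ⟨l, hl, hsol⟩ := h4
        have hlast : (⟨N - 1, by omega⟩ : Fin N).val + 1 = N := by
          show N - 1 + 1 = N
          omega
        have hl' := hl _ hlast
        refine hF (m ω) k hk0 _ _ h2 h3 h1 _ (fun s => X k s ω) l hsol hl'.mono hl'.init ?_
          fun s => Or.inl rfl
        intro u v huv hne
        by_contra! hcon
        refine hne (hl'.const u v huv fun r hr => ?_)
        obtain ⟨i, hi, hpos⟩ := hcon r hr
        rwa [show (⟨N - 1, by omega⟩ : Fin N) = i from Fin.ext (by omega)]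
      · filter_upwards [hWm, hW.cont, hW.sde, hY.solves, hXY] with ω h1 h2 h3 h4 h5
        have hr : (0 : ℝ≥0 → EuclideanSpace ℝ (Fin N)) = fun s => lastCoord N ((fun _ => 0) s) := by
          funext s
          exact lastCoord_zero.symm
        rw [hr] at h4
        exact hF (m ω) k hk0 _ _ h2 h3 h1 _ (fun s => X k s ω) _ h4 monotone_const rfl
          (fun u v _ hne => absurd rfl hne) fun s => Or.inr (h5 s)
  refine ⟨hfirst, fun hcont => ?_⟩
  obtain ⟨C, -, hC⟩ := hfirst
  -- The null set depends on `k`; countably many rational `k` share one, and continuity in `k` does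
  -- the rest.
  have hrat : ∀ᵐ ω ∂P, ∀ q : ℚ, (1 / 2 : ℝ) ≤ q → ∀ s ≤ t,
      √(q : ℝ) * ‖X q s ω - √(q : ℝ) • φ s - W s ω‖ ≤ C ω := by
    refine ae_all_iff.2 fun q => ?_
    by_cases hq : (1 / 2 : ℝ) ≤ q
    · filter_upwards [hC q hq] with ω hω _
      exact hω
    · exact Filter.Eventually.of_forall fun ω h => absurd h hq
  filter_upwards [hcont, hrat] with ω h1 h2
  exact bddAbove_of_forall_rat (X := fun k s => X k s ω) (φ := fun s => φ s)
    (w := fun s => W s ω) h1 h2
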